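/- A GF(2)-grammar over an alphabet $\Sigma$ is an ordinary context-free grammar $G$ with finitely many rules and initial symbol $S$, such that every string $w\in\Sigma^*$ has only finitely many parse trees rooted at $S$; the language it describes is the set of all strings $w$ with an odd number of parse trees rooted at $S$. Theorem 3.2. Let $a\neq b$ be two letters of $\Sigma$ (for example $\Sigma=\{a,b\}$), and suppose that $L\subseteq a^*b^*$ is described by a GF(2)-grammar over $\Sigma$. Let $\mathbb F_2$ be the two-element field, let $\mathrm{Dual}(L)=\sum_{a^nb^m\in L}a^nb^m\in\mathbb F_2[[a,b]]$, where on the right $a,b$ are commuting variables, and write $\mathrm{Dual}(L)=\sum_{i=0}^{\infty}a^i\,\ell(i)$ with $\ell(i)\in\mathbb F_2[[b]]$. Then there exist an integer $d\ge 0$ and polynomials $p_0,p_1,\dots,p_d\in\mathbb F_2[b]$ with $p_d\neq 0$ such that $$\sum_{i=0}^{d}p_i\,\ell(n-i)\in\mathbb F_2[[b]]$$ takes only finitely many distinct values as $n$ ranges over all integers $n>d$. -/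

import Mathlib

open scoped Computability

universe u

mutual
/-- Parse trees of the context-free grammar `g` whose root is labelled by the nonterminal `A`:
a rule `r` of `g` with left-hand side `A`, together with a sequence of subtrees, one for each
symbol of the right-hand side of `r`. -/
inductive ParseTree {T : Type u} (g : ContextFreeGrammar.{u} T) : g.NT → Type u
  | node {A : g.NT} (r : ContextFreeRule T g.NT) (mem : r ∈ g.rules) (input_eq : r.input = A)
      (children : ParseForest g r.output) : ParseTree g A

/-- Sequences of parse trees of `g` whose roots are labelled, in order, by the symbols of a given
string; the tree of a terminal symbol is a single leaf. -/
inductive ParseForest {T : Type u} (g : ContextFreeGrammar.{u} T) : List (Symbol T g.NT) → Type u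
  | nil : ParseForest g []
  | terminal {s : List (Symbol T g.NT)} (t : T) (rest : ParseForest g s) :
      ParseForest g (Symbol.terminal t :: s)
  | nonterminal {s : List (Symbol T g.NT)} {A : g.NT} (tree : ParseTree g A)
      (rest : ParseForest g s) : ParseForest g (Symbol.nonterminal A :: s)
end

mutual
/-- The string of terminals at the leaves of a parse tree, read from left to right. -/
def ParseTree.yield {T : Type u} {g : ContextFreeGrammar.{u} T} {A : g.NT} :
    ParseTree g A → List T
  | .node _ _ _ children => children.yield

/-- The string of terminals at the leaves of a sequence of parse trees. -/
def ParseForest.yield {T : Type u} {g : ContextFreeGrammar.{u} T} {s : List (Symbol T g.NT)} :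
    ParseForest g s → List T
  | .nil => []
  | .terminal t rest => t :: rest.yield
  | .nonterminal tree rest => tree.yield ++ rest.yield
end

/-- The parse trees of the string `w` as the nonterminal `A`. -/
def parseTrees {T : Type u} (g : ContextFreeGrammar.{u} T) (A : g.NT) (w : List T) :
    Set (ParseTree g A) :=
  {t | t.yield = w}

/-- A GF(2)-grammar: a (finite set of rules of a) context-free grammar in which every string has
only finitely many parse trees. -/
structure GF2Grammar (T : Type u) extends ContextFreeGrammar.{u} T where
  /-- Every string has finitely many parse trees (with the initial symbol at the root). -/
  finite_parseTrees : ∀ w : List T, (parseTrees toContextFreeGrammar initial w).Finite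

/-- The language of a GF(2)-grammar: the strings with an odd number of parse trees. -/
def GF2Grammar.language {T : Type u} (G : GF2Grammar T) : Language T :=
  {w | Odd (parseTrees G.toContextFreeGrammar G.initial w).ncard}

/-- The language `L` is described by some GF(2)-grammar. -/
def IsGF2Grammatical {T : Type u} (L : Language T) : Prop :=
  ∃ G : GF2Grammar T, G.language = L

/-- The language `a^* b^*`. -/
def starStar {T : Type u} (a b : T) : Language T :=
  ({[a]} : Language T)∗ * ({[b]} : Language T)∗

open scoped Classical in
/-- The formal power series over GF(2) in two commuting variables (variable `0` plays the role of
`a`, variable `1` that of `b`) in which the monomial `a^n b^m` has coefficient `1` if the string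
`a^n b^m` is in `L`, and coefficient `0` otherwise. -/
noncomputable def dual {T : Type u} (a b : T) (L : Language T) : MvPowerSeries (Fin 2) (ZMod 2) :=
  fun e => if List.replicate (e 0) a ++ List.replicate (e 1) b ∈ L then 1 else 0

/-- The coefficient `ℓ(i)`, a power series in the variable `1`, of the `i`-th power of the
variable `0` in a two-variable power series `f`, that is, `f = ∑ i, a^i ℓ(i)`. -/
noncomputable def coeffA (f : MvPowerSeries (Fin 2) (ZMod 2)) (i : ℕ) : PowerSeries (ZMod 2) :=
  PowerSeries.mk fun j => MvPowerSeries.coeff (Finsupp.single 0 i + Finsupp.single 1 j) f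

/-!
For every symbol of the grammar, split the series counting its parse trees of the strings `aⁿ bᵐ`
into the part with `m = 0` and the part with `m > 0`. In a product of series, the first `b` of a
string lies in exactly one factor, so every factor before that one contributes powers of `a` only,
and every factor after it powers of `b` only. The parts with `m > 0` therefore solve a *linear*
system whose coefficients are polynomials in one-letter series, that is, in elements of `k⟦a⟧` and
of `k⟦b⟧`.

The one-letter series solve a polynomial system whose Jacobian matrix is `1 - N`, where the constant
terms of `N` count parse trees with the empty word below all leaves but one. Finiteness of the sets
of parse trees makes the nonzero entries of the constant part of `N` acyclic, hence `det (1 - N)`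
is nonzero. Consequently all derivations over the coefficient ring kill the one-letter series, which
are therefore algebraic.

The matrix of the linear system has the same constant terms, and Cramer's rule multiplies its
solution into the algebra of series `∑ aⁱ ℓ(i)` whose coefficients `ℓ(i)` span a finitely generated
`k`-module. The determinant is algebraic, so it divides a nonzero polynomial `p` of `k[b][a]` by a
cofactor in the same algebra, and the coefficients of `p` with respect to `a` give the recurrence.
-/

section AlgebraicSystems

open MvPolynomial

theorem derivation_eq_zero_of_adjoin_eq_top {k E M : Type*} [Field k] [Field E] [Algebra k E]
    [AddCommGroup M] [Module k M] [Module E M] {D : Derivation k E M} {s : Set E}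
    (hs : IntermediateField.adjoin k s = ⊤) (hD : Set.EqOn D 0 s) : D = 0 := by
  ext z
  obtain ⟨r, hr, t, ht, rfl⟩ := IntermediateField.mem_adjoin_iff_div.1
    (hs ▸ IntermediateField.mem_top : z ∈ IntermediateField.adjoin k s)
  have hD' := Derivation.eqOn_adjoin (D1 := D) (D2 := 0) hD
  simp [D.leibniz_div, hD' hr, hD' ht]

theorem isAlgebraic_of_forall_D_eq_zero {k E ι : Type*} [Field k] [Field E] [Algebra k E]
    [Finite ι] {x : ι → E} (hx : IntermediateField.adjoin k (Set.range x) = ⊤)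
    (hD : ∀ i, KaehlerDifferential.D k E (x i) = 0) : Algebra.IsAlgebraic k E := by
  have : Algebra.EssFiniteType k E :=
    IntermediateField.fg_top_iff.1 (hx ▸ IntermediateField.fg_adjoin_of_finite (Set.finite_range x))
  have hzero : KaehlerDifferential.D k E = 0 :=
    derivation_eq_zero_of_adjoin_eq_top hx (Set.forall_mem_range.2 hD)
  have : Algebra.FormallyUnramified k E := by
    refine ⟨?_⟩
    rw [← Submodule.subsingleton_iff E, ← subsingleton_iff_bot_eq_top,
      ← KaehlerDifferential.span_range_derivation, eq_comm, Submodule.span_eq_bot]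
    simp [hzero]
  have := Algebra.FormallyUnramified.isSeparable k E
  infer_instance

theorem derivation_aeval_mvPolynomial {R A M ι : Type*} [CommRing R] [CommRing A] [Algebra R A]
    [AddCommGroup M] [Module R M] [Module A M] [Fintype ι]
    (D : Derivation R A M) (x : ι → A) (f : MvPolynomial ι R) :
    D (aeval x f) = ∑ j, aeval x (pderiv j f) • D (x j) := by
  classical
  induction f using MvPolynomial.induction_on with
  | C r => simp
  | add p q hp hq => simp only [map_add, hp, hq, add_smul, Finset.sum_add_distrib]
  | mul_X p i hp =>
    have hsingle : ∑ j, aeval x p • aeval x (pderiv j (X i : MvPolynomial ι R)) • D (x j) =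
        aeval x p • D (x i) := by
      simp [pderiv_X, Pi.single_apply, Finset.sum_ite_eq]
    simp only [map_mul, Derivation.leibniz, hp, aeval_X, smul_eq_mul, map_add, add_smul,
      Finset.sum_add_distrib, Finset.smul_sum, mul_smul, hsingle]

/-- A zero `x` of the square polynomial system `x i = f i (x)` whose Jacobian determinant is
nonzero. -/
structure IsNondegenerateFixedPoint {R K ι : Type*} [CommRing R] [CommRing K] [Algebra R K]
    [Fintype ι] [DecidableEq ι] (f : ι → MvPolynomial ι R) (x : ι → K) : Prop where
  eq_aeval : ∀ i, x i = aeval x (f i)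
  det_ne_zero : (1 - Matrix.of fun i j => aeval x (pderiv j (f i))).det ≠ 0

namespace IsNondegenerateFixedPoint

variable {R K ι : Type*} [CommRing R] [CommRing K] [Algebra R K] [Fintype ι] [DecidableEq ι]

theorem comp_algHom_iff {L : Type*} [CommRing L] [Algebra R L] {φ : K →ₐ[R] L}
    (hφ : Function.Injective φ) {f : ι → MvPolynomial ι R} {x : ι → K} :
    IsNondegenerateFixedPoint f (φ ∘ x) ↔ IsNondegenerateFixedPoint f x := by
  have haeval (p : MvPolynomial ι R) : aeval (φ ∘ x) p = φ (aeval x p) :=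
    (comp_aeval_apply x φ p).symm
  have hdet : (1 - Matrix.of fun i j => aeval (φ ∘ x) (pderiv j (f i))).det =
      φ (1 - Matrix.of fun i j => aeval x (pderiv j (f i))).det := by
    rw [AlgHom.map_det, map_sub, map_one]
    simp only [haeval]
    rfl
  constructor
  · rintro ⟨h₁, h₂⟩
    exact ⟨fun i => hφ ((h₁ i).trans (haeval _)), (map_ne_zero_iff φ hφ).1 (hdet ▸ h₂)⟩
  · rintro ⟨h₁, h₂⟩
    exact ⟨fun i => (congrArg φ (h₁ i)).trans (haeval _).symm,
      hdet ▸ (map_ne_zero_iff φ hφ).2 h₂⟩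

theorem map_algebraMap {f : ι → MvPolynomial ι R} {x : ι → K}
    (h : IsNondegenerateFixedPoint f x) (S : Type*) [CommRing S] [Algebra R S] [Algebra S K]
    [IsScalarTower R S K] :
    IsNondegenerateFixedPoint (fun i => map (algebraMap R S) (f i)) x where
  eq_aeval i := by rw [aeval_map_algebraMap, ← h.eq_aeval]
  det_ne_zero := by simpa only [pderiv_map, aeval_map_algebraMap] using h.det_ne_zero

theorem D_eq_zero {k E : Type*} [CommRing k] [Field E] [Algebra k E] {f : ι → MvPolynomial ι k}
    {x : ι → E} (h : IsNondegenerateFixedPoint f x) (i : ι) :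
    KaehlerDifferential.D k E (x i) = 0 := by
  set D := KaehlerDifferential.D k E
  set M := 1 - Matrix.of fun i j => aeval x (pderiv j (f i)) with hM
  have hMD (i) : ∑ j, M i j • D (x j) = 0 := by
    simp only [hM, Matrix.sub_apply, sub_smul, Finset.sum_sub_distrib, Matrix.of_apply,
      ← derivation_aeval_mvPolynomial, ← h.eq_aeval]
    simp [Matrix.one_apply]
  calc D (x i) = ∑ l, (M⁻¹ * M) i l • D (x l) := by
        rw [Matrix.nonsing_inv_mul _ (isUnit_iff_ne_zero.2 h.det_ne_zero)]
        simp [Matrix.one_apply]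
    _ = ∑ j, M⁻¹ i j • ∑ l, M j l • D (x l) := by
        simp only [Matrix.mul_apply, Finset.sum_smul, Finset.smul_sum, smul_smul]
        exact Finset.sum_comm
    _ = 0 := by simp only [hMD, smul_zero, Finset.sum_const_zero]

theorem isAlgebraic_of_field {k F : Type*} [Field k] [Field F] [Algebra k F]
    {f : ι → MvPolynomial ι k} {x : ι → F} (h : IsNondegenerateFixedPoint f x) (i : ι) :
    IsAlgebraic k (x i) := by
  let E := IntermediateField.adjoin k (Set.range x)
  let y (i : ι) : E := ⟨x i, IntermediateField.subset_adjoin _ _ ⟨i, rfl⟩⟩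
  have hy : IsNondegenerateFixedPoint f y := (comp_algHom_iff E.val.injective).1 h
  have htop : IntermediateField.adjoin k (Set.range y) = ⊤ := by
    refine IntermediateField.lift_injective E ?_
    rw [IntermediateField.lift_adjoin, IntermediateField.lift_top, ← Set.range_comp]
    rfl
  have := isAlgebraic_of_forall_D_eq_zero htop hy.D_eq_zero
  exact (isAlgebraic_algHom_iff E.val E.val.injective).2 (Algebra.IsAlgebraic.isAlgebraic (y i))

theorem isAlgebraic [IsDomain R] [IsDomain K] [FaithfulSMul R K] {f : ι → MvPolynomial ι R}
    {x : ι → K} (h : IsNondegenerateFixedPoint f x) (i : ι) : IsAlgebraic R (x i) := by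
  let k := FractionRing R
  let F := FractionRing K
  let : Algebra k F := FractionRing.liftAlgebra R F
  let φ : K →ₐ[R] F := IsScalarTower.toAlgHom R K F
  have hφ : Function.Injective φ := IsFractionRing.injective K F
  have halg : IsAlgebraic k (φ (x i)) :=
    isAlgebraic_of_field (((comp_algHom_iff hφ).2 h).map_algebraMap k) i
  rw [← IsFractionRing.isAlgebraic_iff R k F] at halg
  exact (isAlgebraic_algHom_iff φ hφ).1 halg

end IsNondegenerateFixedPoint

end AlgebraicSystems

section LinearSystems

open Matrix

theorem exists_ne_zero_algebraMap_mul_mem_of_mulVec_eq {R K ι : Type*} [CommRing R] [CommRing K]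
    [IsDomain K] [Algebra R K] [Fintype ι] [DecidableEq ι] {S : Subalgebra R K}
    (hS : ∀ z ∈ S, IsAlgebraic R z) {M : Matrix ι ι K} (hM : ∀ i j, M i j ∈ S)
    (hdet : M.det ≠ 0) {f q : ι → K} (hf : ∀ i, f i ∈ S) (hq : M *ᵥ q = f) (i : ι) :
    ∃ p : R, p ≠ 0 ∧ algebraMap R K p * q i ∈ S := by
  lift f to ι → S using hf
  obtain ⟨M, rfl⟩ : ∃ M' : Matrix ι ι S, M'.map S.val = M := ⟨.of fun i j => ⟨M i j, hM i j⟩, rfl⟩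
  have hdet_val : (M.map S.val).det = S.val M.det := (AlgHom.map_det S.val M).symm
  have hcramer : S.val M.det * q i = S.val ((M.adjugate *ᵥ f) i) := by
    have hadjugate : (M.map S.val).adjugate = M.adjugate.map S.val :=
      (RingHom.map_adjugate S.val.toRingHom M).symm
    calc S.val M.det * q i = ((M.map S.val).adjugate *ᵥ (M.map S.val *ᵥ q)) i := by
          rw [mulVec_mulVec, adjugate_mul, smul_mulVec, one_mulVec, hdet_val]
          rfl
      _ = S.val ((M.adjugate *ᵥ f) i) := by
          rw [hq, hadjugate]
          exact (RingHom.map_mulVec S.val.toRingHom M.adjugate f i).symm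
  have halg : IsAlgebraic R M.det :=
    (isAlgebraic_algHom_iff S.val Subtype.val_injective).1 (hS _ M.det.2)
  obtain ⟨p, hp, u, hu⟩ := halg.exists_nonzero_dvd
    (mem_nonZeroDivisors_of_ne_zero fun h => hdet (by rw [hdet_val, h, map_zero]))
  refine ⟨p, hp, ?_⟩
  have hpu : algebraMap R K p = S.val u * S.val M.det := by
    rw [← map_mul, mul_comm u, ← hu]
    rfl
  rw [hpu, mul_assoc, hcramer]
  exact S.mul_mem u.2 (Subtype.property _)

theorem det_one_sub_ne_zero_of_wellFounded {K ι : Type*} [CommRing K] [IsDomain K] [Fintype ι]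
    [DecidableEq ι] {M : Matrix ι ι K} (hM : WellFounded fun j i => M i j ≠ 0) :
    (1 - M).det ≠ 0 := by
  intro hdet
  obtain ⟨v, hv, hMv⟩ := exists_mulVec_eq_zero_iff.2 hdet
  rw [sub_mulVec, one_mulVec, sub_eq_zero] at hMv
  refine hv ?_
  ext i
  induction i using hM.induction with
  | _ i ih =>
    rw [hMv]
    refine Finset.sum_eq_zero fun j _ => ?_
    by_cases h : M i j = 0
    · exact mul_eq_zero_of_left h _
    · exact mul_eq_zero_of_right _ (ih j h)

end LinearSystems

section SkewDerivation

variable {σ K : Type*} [CommRing K]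

/-- The `(p, q)`-derivation of the free monoid on `σ` (a skew, or Fox, derivation): the linear form
`δ(x₁ ⋯ xₙ) = ∑ i, p(x₁) ⋯ p(xᵢ₋₁) δ(xᵢ) q(xᵢ₊₁) ⋯ q(xₙ)` in the values `δ(x)` on letters. -/
def skewDerivation (p q : σ → K) : List σ → (σ → K) →ₗ[K] K
  | [] => 0
  | x :: s => (s.map q).prod • LinearMap.proj x + p x • skewDerivation p q s

@[simp]
theorem skewDerivation_nil (p q δ : σ → K) : skewDerivation p q [] δ = 0 :=
  rfl

theorem skewDerivation_cons (p q δ : σ → K) (x : σ) (s : List σ) :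
    skewDerivation p q (x :: s) δ = (s.map q).prod * δ x + p x * skewDerivation p q s δ :=
  rfl

theorem map_skewDerivation {L : Type*} [CommRing L] (φ : K →+* L) (p q δ : σ → K) (s : List σ) :
    φ (skewDerivation p q s δ) = skewDerivation (φ ∘ p) (φ ∘ q) s (φ ∘ δ) := by
  induction s with
  | nil => exact map_zero φ
  | cons x s ih => simp [skewDerivation_cons, ih, map_list_prod]

theorem skewDerivation_mem {R : Type*} [CommRing R] [Algebra R K] {S : Subalgebra R K}
    {p q δ : σ → K} (hp : ∀ x, p x ∈ S) (hq : ∀ x, q x ∈ S) (hδ : ∀ x, δ x ∈ S) (s : List σ) :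
    skewDerivation p q s δ ∈ S := by
  induction s with
  | nil => exact S.zero_mem
  | cons x s ih =>
    have hprod : (s.map q).prod ∈ S := S.list_prod_mem (by simpa using fun x _ => hq x)
    exact S.add_mem (S.mul_mem hprod (hδ x)) (S.mul_mem (hp x) ih)

theorem derivation_list_prod_map {R : Type*} [CommRing R] [Algebra R K] (D : Derivation R K K)
    (P : σ → K) (s : List σ) : D (s.map P).prod = skewDerivation P P s (D ∘ P) := by
  induction s with
  | nil => simp
  | cons x s ih =>
    simp only [List.map_cons, List.prod_cons, D.leibniz, ih, skewDerivation_cons, smul_eq_mul,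
      Function.comp_apply]
    ring

end SkewDerivation

section DoublePowerSeries

open Polynomial PowerSeries

variable {k : Type*} [CommRing k]

theorem coeff_algebraMap_polynomial_polynomial (p : k[X][X]) (n : ℕ) :
    PowerSeries.coeff n (algebraMap k[X][X] k⟦X⟧⟦X⟧ p) = (p.coeff n : k⟦X⟧) := by
  simp [PowerSeries.algebraMap_apply']

instance : FaithfulSMul k[X] k⟦X⟧ := by
  rw [faithfulSMul_iff_algebraMap_injective]
  intro p q h
  simpa [PowerSeries.algebraMap_apply'] using h

/-- The double power series whose coefficients with respect to the outer variable lie in a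
finitely generated `k`-module. -/
def fgCoeffSubalgebra (k : Type*) [CommRing k] : Subalgebra k[X][X] k⟦X⟧⟦X⟧ where
  carrier := {f | ∃ V : Submodule k k⟦X⟧, V.FG ∧ ∀ n, PowerSeries.coeff n f ∈ V}
  mul_mem' := by
    rintro f g ⟨V, hV, hf⟩ ⟨W, hW, hg⟩
    refine ⟨V * W, hV.mul hW, fun n => ?_⟩
    rw [PowerSeries.coeff_mul]
    exact Submodule.sum_mem _ fun i _ => Submodule.mul_mem_mul (hf _) (hg _)
  add_mem' := by
    rintro f g ⟨V, hV, hf⟩ ⟨W, hW, hg⟩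
    exact ⟨V ⊔ W, hV.sup hW, fun n => map_add (PowerSeries.coeff n) f g ▸
      Submodule.add_mem_sup (hf n) (hg n)⟩
  algebraMap_mem' p := by
    refine ⟨Submodule.span k ((fun n => (p.coeff n : k⟦X⟧)) '' p.support),
      Submodule.fg_span (p.support.finite_toSet.image _), fun n => ?_⟩
    rw [coeff_algebraMap_polynomial_polynomial]
    by_cases hn : n ∈ p.support
    · exact Submodule.subset_span ⟨n, hn, rfl⟩
    · simp [Polynomial.notMem_support_iff.1 hn]

theorem C_mem_fgCoeffSubalgebra (g : k⟦X⟧) : PowerSeries.C g ∈ fgCoeffSubalgebra k := by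
  refine ⟨Submodule.span k {g}, Submodule.fg_span_singleton g, fun n => ?_⟩
  rw [PowerSeries.coeff_C]
  split_ifs
  · exact Submodule.mem_span_singleton_self g
  · exact Submodule.zero_mem _

theorem map_C_mem_fgCoeffSubalgebra (g : k⟦X⟧) :
    PowerSeries.map PowerSeries.C g ∈ fgCoeffSubalgebra k := by
  refine ⟨Submodule.span k {1}, Submodule.fg_span_singleton 1, fun n => ?_⟩
  rw [PowerSeries.coeff_map, Submodule.mem_span_singleton]
  exact ⟨PowerSeries.coeff n g, by rw [PowerSeries.smul_eq_C_mul, mul_one]⟩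

theorem coeff_algebraMap_polynomial_mul (p : k[X][X]) (h : k⟦X⟧⟦X⟧) {n : ℕ}
    (hn : p.natDegree ≤ n) :
    PowerSeries.coeff n (algebraMap k[X][X] k⟦X⟧⟦X⟧ p * h) =
      ∑ i : Fin (p.natDegree + 1), (p.coeff i : k⟦X⟧) * PowerSeries.coeff (n - i) h := by
  rw [PowerSeries.coeff_mul, Finset.Nat.sum_antidiagonal_eq_sum_range_succ_mk,
    Fin.sum_univ_eq_sum_range fun i => (p.coeff i : k⟦X⟧) * PowerSeries.coeff (n - i) h]
  simp only [coeff_algebraMap_polynomial_polynomial]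
  refine (Finset.sum_subset (Finset.range_subset_range.2 (by lia)) fun i _ hi => ?_).symm
  rw [Polynomial.coeff_eq_zero_of_natDegree_lt (by simpa using hi), Polynomial.coe_zero, zero_mul]

end DoublePowerSeries

section WordSeries

open PowerSeries

variable {T k : Type*} [CommRing k]

/-- The product of two noncommutative power series. -/
def wordConv (f g : List T → k) (w : List T) : k :=
  ∑ i ∈ Finset.range (w.length + 1), f (w.take i) * g (w.drop i)

theorem zero_wordConv (g : List T → k) : wordConv 0 g = 0 := by
  ext w
  simp [wordConv]

theorem wordConv_zero (f : List T → k) : wordConv f 0 = 0 := by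
  ext w
  simp [wordConv]

open scoped Classical in
/-- The ordered product of a list of noncommutative power series; the empty product is the series
of the empty word. -/
noncomputable def wordProd (l : List (List T → k)) : List T → k :=
  l.foldr wordConv (Pi.single [] 1)

/-- The image of a noncommutative power series under the substitution sending the letter `a` to
the variable and all other letters to `0`. -/
def letterSeries (a : T) : (List T → k) →ₗ[k] k⟦X⟧ where
  toFun f := mk fun n => f (List.replicate n a)
  map_add' _ _ := rfl
  map_smul' _ _ := rfl

/-- The part of a noncommutative power series supported on `a* b⁺`, with the letters commuting: `a`
is the outer variable and `b` the inner one. Powers of `a` alone are excluded so that the series of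
a product splits as in `mixedSeries_wordConv`. -/
def mixedSeries (a b : T) : (List T → k) →ₗ[k] k⟦X⟧⟦X⟧ where
  toFun f := mk fun n => mk fun m =>
    if m = 0 then 0 else f (List.replicate n a ++ List.replicate m b)
  map_add' f g := by
    ext n m
    by_cases hm : m = 0 <;> simp [hm]
  map_smul' c f := by
    ext n m
    by_cases hm : m = 0 <;> simp [hm]

@[simp]
theorem coeff_letterSeries (a : T) (f : List T → k) (n : ℕ) :
    coeff n (letterSeries a f) = f (List.replicate n a) :=
  coeff_mk n fun n => f (List.replicate n a)

theorem coeff_coeff_mixedSeries (a b : T) (f : List T → k) (n m : ℕ) :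
    coeff m (coeff n (mixedSeries a b f)) =
      if m = 0 then 0 else f (List.replicate n a ++ List.replicate m b) := by
  simp [mixedSeries]

theorem constantCoeff_letterSeries (a : T) (f : List T → k) :
    constantCoeff (letterSeries a f) = f [] := by
  simp [← coeff_zero_eq_constantCoeff_apply]

theorem coeff_map_letterSeries_add_mixedSeries (a b : T) (f : List T → k) (n : ℕ) :
    coeff n (map C (letterSeries a f) + mixedSeries a b f) =
      mk fun m => f (List.replicate n a ++ List.replicate m b) := by
  ext m
  rcases m with _ | m <;> simp [mixedSeries]

theorem letterSeries_wordConv (a : T) (f g : List T → k) :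
    letterSeries a (wordConv f g) = letterSeries a f * letterSeries a g := by
  ext n
  rw [coeff_mul, Finset.Nat.sum_antidiagonal_eq_sum_range_succ_mk, coeff_letterSeries, wordConv,
    List.length_replicate]
  refine Finset.sum_congr rfl fun i hi => ?_
  simp [List.take_replicate, List.drop_replicate,
    Nat.min_eq_left (Nat.lt_succ_iff.1 (Finset.mem_range.1 hi))]

open scoped Classical in
theorem letterSeries_single_nil (a : T) :
    letterSeries a (Pi.single [] 1 : List T → k) = 1 := by
  ext n
  simp [Pi.single_apply, coeff_one]

open scoped Classical in
theorem letterSeries_single_singleton (a t : T) :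
    letterSeries a (Pi.single [t] 1 : List T → k) = if a = t then X else 0 := by
  ext n
  split_ifs with h <;>
    rcases n with _ | _ | n <;> simp [List.replicate_succ, coeff_X, h]

theorem letterSeries_wordProd (a : T) (l : List (List T → k)) :
    letterSeries a (wordProd l) = (l.map (letterSeries a)).prod := by
  induction l with
  | nil => exact letterSeries_single_nil a
  | cons f l ih => rw [List.map_cons, List.prod_cons, ← ih, ← letterSeries_wordConv]; rfl

theorem wordConv_replicate_append_replicate (a b : T) (f g : List T → k) (n m : ℕ) :
    wordConv f g (List.replicate n a ++ List.replicate m b) =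
      (∑ i ∈ Finset.range (n + 1), f (List.replicate i a) *
        g (List.replicate (n - i) a ++ List.replicate m b)) +
      ∑ j ∈ Finset.range m, f (List.replicate n a ++ List.replicate (j + 1) b) *
        g (List.replicate (m - (j + 1)) b) := by
  have hlength : (List.replicate n a ++ List.replicate m b).length + 1 = (n + 1) + m := by
    simp only [List.length_append, List.length_replicate]
    lia
  rw [wordConv, hlength, Finset.sum_range_add]
  congr 1
  · refine Finset.sum_congr rfl fun i hi => ?_
    have hi : i ≤ n := Nat.lt_succ_iff.1 (Finset.mem_range.1 hi)
    simp [List.take_append, List.drop_append, List.take_replicate, List.drop_replicate, hi,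
      Nat.sub_eq_zero_of_le hi]
  · refine Finset.sum_congr rfl fun j hj => ?_
    have hj : j + 1 ≤ m := Finset.mem_range.1 hj
    have h₁ : n + 1 + j - n = j + 1 := by lia
    have h₂ : n - (n + 1 + j) = 0 := by lia
    simp [List.take_append, List.drop_append, List.take_replicate, List.drop_replicate, hj, h₁, h₂,
      (by lia : n ≤ n + 1 + j)]

theorem mixedSeries_wordConv (a b : T) (f g : List T → k) :
    mixedSeries a b (wordConv f g) =
      map C (letterSeries a f) * mixedSeries a b g + mixedSeries a b f * C (letterSeries b g) := by
  ext n m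
  rcases Nat.eq_zero_or_pos m with rfl | hm
  · simp [coeff_mul, mixedSeries]
  · rw [coeff_coeff_mixedSeries, if_neg hm.ne', wordConv_replicate_append_replicate, map_add,
      map_add]
    congr 1
    · rw [coeff_mul, Finset.Nat.sum_antidiagonal_eq_sum_range_succ_mk, map_sum]
      refine Finset.sum_congr rfl fun i _ => ?_
      simp [coeff_coeff_mixedSeries, hm.ne']
    · rw [coeff_mul_C, coeff_mul, Finset.Nat.sum_antidiagonal_eq_sum_range_succ_mk,
        Finset.sum_range_succ']
      simp [coeff_coeff_mixedSeries]

open scoped Classical in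
theorem mixedSeries_single_nil (a b : T) :
    mixedSeries a b (Pi.single [] 1 : List T → k) = 0 := by
  ext n m
  simp +contextual [coeff_coeff_mixedSeries]

open scoped Classical in
theorem mixedSeries_single_singleton (a b t : T) :
    mixedSeries a b (Pi.single [t] 1 : List T → k) = C (letterSeries b (Pi.single [t] 1)) := by
  ext n m
  rcases n with _ | n <;> rcases m with _ | m <;>
    simp [mixedSeries, coeff_C, List.replicate_succ]

/-- Along a factorization of `aⁿ bᵐ` with `m > 0`, exactly one factor contains the first `b`. -/
theorem mixedSeries_wordProd_map {σ : Type*} (a b : T) (c : σ → List T → k) (s : List σ) :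
    mixedSeries a b (wordProd (s.map c)) =
      skewDerivation (fun x => map C (letterSeries a (c x))) (fun x => C (letterSeries b (c x))) s
        fun x => mixedSeries a b (c x) := by
  induction s with
  | nil => exact mixedSeries_single_nil a b
  | cons x s ih =>
    have hcons : wordProd ((x :: s).map c) = wordConv (c x) (wordProd (s.map c)) := rfl
    rw [hcons, mixedSeries_wordConv, ih, letterSeries_wordProd, skewDerivation_cons, map_list_prod,
      List.map_map, List.map_map, add_comm, mul_comm (mixedSeries a b (c x))]
    rfl

end WordSeries

section FiberCounting

variable {α β γ δ : Type*}

/-- A map whose fibers are all finite; their cardinalities are the values of `fiberCount`. -/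
def HasFiniteFibers (y : α → β) : Prop :=
  ∀ w, (y ⁻¹' {w}).Finite

/-- The number of preimages, as an element of `k`. Infinite fibers count as `0`. -/
noncomputable def fiberCount (k : Type*) [NatCast k] (y : α → β) (w : β) : k :=
  (y ⁻¹' {w}).ncard

theorem HasFiniteFibers.of_injective {y : α → β} {z : γ → δ} (hz : HasFiniteFibers z)
    {e : α → γ} (he : Function.Injective e) {c : β → δ} (h : ∀ x, z (e x) = c (y x)) :
    HasFiniteFibers y := fun w =>
  ((hz (c w)).preimage he.injOn).subset fun x (hx : y x = w) => (h x).trans (congrArg c hx)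

theorem fiberCount_comp_of_bijective (k : Type*) [NatCast k] {e : α → β}
    (he : Function.Bijective e) (y : β → γ) : fiberCount k (y ∘ e) = fiberCount k y := by
  ext w
  rw [fiberCount, fiberCount, Set.preimage_comp, Set.ncard_preimage_of_injective_subset_range
    he.injective (by simp [he.surjective.range_eq])]

theorem fiberCount_eq_zero_of_isEmpty (k : Type*) [AddMonoidWithOne k] [IsEmpty α] (y : α → β) :
    fiberCount k y = 0 := by
  ext w
  simp [fiberCount, Set.eq_empty_of_isEmpty]

theorem fiberCount_of_unique (k : Type*) [AddMonoidWithOne k] [Unique α] [DecidableEq β]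
    (y : α → β) : fiberCount k y = Pi.single (y default) 1 := by
  ext w
  rw [Pi.single_apply, fiberCount]
  split_ifs with hw
  · have hfiber : y ⁻¹' {w} = {default} := by ext x; simp [Unique.eq_default x, hw]
    rw [hfiber, Set.ncard_singleton, Nat.cast_one]
  · have hfiber : y ⁻¹' {w} = ∅ := by ext x; simp [Unique.eq_default x, Ne.symm hw]
    rw [hfiber, Set.ncard_empty, Nat.cast_zero]

theorem fiberCount_sigma (k : Type*) [AddCommMonoidWithOne k] {ι : Type*} [Fintype ι]
    {α : ι → Type*} {y : ∀ i, α i → β} (hy : ∀ i, HasFiniteFibers (y i)) :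
    fiberCount k (fun x : Σ i, α i => y x.1 x.2) = ∑ i, fiberCount k (y i) := by
  ext w
  have hfiber : (fun x : Σ i, α i => y x.1 x.2) ⁻¹' {w} = ⋃ i, Sigma.mk i '' (y i ⁻¹' {w}) := by
    ext ⟨i, x⟩
    simp only [Set.mem_preimage, Set.mem_singleton_iff, Set.mem_iUnion, Set.mem_image]
    exact ⟨fun h => ⟨i, x, h, rfl⟩, by rintro ⟨_, _, h, h'⟩; cases h'; exact h⟩
  have hdisjoint : Pairwise (Function.onFun Disjoint fun i => Sigma.mk i '' (y i ⁻¹' {w})) := by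
    intro i j hij
    refine Set.disjoint_left.2 ?_
    rintro _ ⟨x, -, rfl⟩ ⟨x', -, h⟩
    exact hij (congrArg Sigma.fst h).symm
  rw [fiberCount, hfiber, Set.ncard_iUnion_of_finite (fun i => (hy i w).image _) hdisjoint,
    finsum_eq_sum_of_fintype, Nat.cast_sum, Finset.sum_apply]
  exact Finset.sum_congr rfl fun i _ =>
    congrArg _ (Set.ncard_image_of_injective _ sigma_mk_injective)

theorem fiberCount_append (k : Type*) [CommRing k] {T : Type*} {y : α → List T} {z : γ → List T}
    (hy : HasFiniteFibers y) (hz : HasFiniteFibers z) :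
    fiberCount k (fun x : α × γ => y x.1 ++ z x.2) =
      wordConv (fiberCount k y) (fiberCount k z) := by
  ext w
  let fiber (i : Fin (w.length + 1)) : Set (α × γ) :=
    (y ⁻¹' {w.take i}) ×ˢ (z ⁻¹' {w.drop i})
  have hlength {i : Fin (w.length + 1)} {x : α × γ} (hx : x ∈ fiber i) : (y x.1).length = i := by
    rw [show y x.1 = w.take i from hx.1, List.length_take]
    lia
  have hfiber : (fun x : α × γ => y x.1 ++ z x.2) ⁻¹' {w} = ⋃ i, fiber i := by
    ext x
    simp only [Set.mem_preimage, Set.mem_singleton_iff, Set.mem_iUnion]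
    constructor
    · intro hx
      exact ⟨⟨(y x.1).length, by simp [← hx]⟩, by simp [fiber, ← hx]⟩
    · rintro ⟨i, hi₁, hi₂⟩
      rw [show y x.1 = w.take i from hi₁, show z x.2 = w.drop i from hi₂, List.take_append_drop]
  have hdisjoint : Pairwise (Function.onFun Disjoint fiber) := fun i j hij =>
    Set.disjoint_left.2 fun x hi hj => hij (Fin.ext ((hlength hi).symm.trans (hlength hj)))
  rw [fiberCount, hfiber, Set.ncard_iUnion_of_finite (fun i => (hy _).prod (hz _)) hdisjoint,
    finsum_eq_sum_of_fintype, Nat.cast_sum, wordConv, ← Fin.sum_univ_eq_sum_range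
      fun i => fiberCount k y (w.take i) * fiberCount k z (w.drop i)]
  exact Finset.sum_congr rfl fun i _ => by rw [Set.ncard_prod, Nat.cast_mul]; rfl

end FiberCounting

section ParseTrees

variable {T : Type u} {g : ContextFreeGrammar.{u} T}

/-- The parse trees whose root is labelled by a given symbol; that of a terminal is a single
leaf. -/
def SymbolTree (g : ContextFreeGrammar.{u} T) : Symbol T g.NT → Type u
  | .terminal _ => PUnit
  | .nonterminal A => ParseTree g A

/-- The string of terminals at the leaves of the parse tree of a symbol. -/
def SymbolTree.yield : ∀ {x : Symbol T g.NT}, SymbolTree g x → List T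
  | .terminal t, _ => [t]
  | .nonterminal _, tree => ParseTree.yield tree

/-- The sequence of parse trees with a given first tree and a given rest. -/
def ParseForest.cons {s : List (Symbol T g.NT)} :
    ∀ {x : Symbol T g.NT}, SymbolTree g x × ParseForest g s → ParseForest g (x :: s)
  | .terminal t, f => .terminal t f.2
  | .nonterminal _, f => .nonterminal f.1 f.2

theorem ParseForest.yield_cons {x : Symbol T g.NT} {s : List (Symbol T g.NT)}
    (f : SymbolTree g x × ParseForest g s) : (cons f).yield = f.1.yield ++ f.2.yield := by
  cases x <;> rfl

theorem ParseForest.cons_bijective (x : Symbol T g.NT) (s : List (Symbol T g.NT)) :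
    Function.Bijective (cons : SymbolTree g x × ParseForest g s → ParseForest g (x :: s)) := by
  cases x with
  | terminal t =>
    refine ⟨fun ⟨_, f⟩ ⟨_, f'⟩ h => ?_, fun f => ?_⟩
    · exact Prod.ext rfl (ParseForest.terminal.inj h)
    · cases f with | terminal _ f => exact ⟨(⟨⟩, f), rfl⟩
  | nonterminal A =>
    refine ⟨fun ⟨_, f⟩ ⟨_, f'⟩ h => ?_, fun f => ?_⟩
    · exact Prod.ext_iff.2 (ParseForest.nonterminal.inj h)
    · cases f with | nonterminal t f => exact ⟨(t, f), rfl⟩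

instance : Unique (ParseForest g []) where
  default := .nil
  uniq f := by cases f; rfl

open scoped Classical in
/-- The rules with left-hand side `A`. -/
noncomputable def rulesOf (g : ContextFreeGrammar.{u} T) (A : g.NT) :
    Finset (ContextFreeRule T g.NT) :=
  {r ∈ g.rules | r.input = A}

theorem mem_rulesOf {A : g.NT} {r : ContextFreeRule T g.NT} :
    r ∈ rulesOf g A ↔ r ∈ g.rules ∧ r.input = A := by
  simp [rulesOf]

/-- The parse tree with a given rule at the root and given subtrees. -/
def ParseTree.ofRule {A : g.NT} (f : Σ r : rulesOf g A, ParseForest g r.1.output) :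
    ParseTree g A :=
  .node f.1 (mem_rulesOf.1 f.1.2).1 (mem_rulesOf.1 f.1.2).2 f.2

theorem ParseTree.ofRule_bijective (A : g.NT) :
    Function.Bijective (ofRule : (Σ r : rulesOf g A, ParseForest g r.1.output) → _) := by
  refine ⟨?_, fun ⟨r, hr, hA, f⟩ => ⟨⟨⟨r, mem_rulesOf.2 ⟨hr, hA⟩⟩, f⟩, rfl⟩⟩
  rintro ⟨⟨r, hr⟩, f⟩ ⟨⟨r', hr'⟩, f'⟩ h
  cases h
  rfl

/-- A symbol is useful if it has parse trees, but only finitely many of each string. -/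
def IsUseful (g : ContextFreeGrammar.{u} T) (x : Symbol T g.NT) : Prop :=
  Nonempty (SymbolTree g x) ∧ HasFiniteFibers (SymbolTree.yield : SymbolTree g x → List T)

theorem isUseful_terminal (t : T) : IsUseful g (.terminal t) :=
  ⟨⟨⟨⟩⟩, fun _ => Set.toFinite (α := PUnit) _⟩

open scoped Classical in
/-- The noncommutative power series counting the parse trees of a useful symbol by their yields.
For the other symbols it is `0`; no parse tree of a useful symbol contains them. -/
noncomputable def symbolSeries (k : Type*) [CommRing k] (g : ContextFreeGrammar.{u} T)
    (x : Symbol T g.NT) : List T → k :=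
  if IsUseful g x then fiberCount k (SymbolTree.yield : SymbolTree g x → List T) else 0

variable {k : Type*} [CommRing k]

theorem symbolSeries_of_not_isUseful {x : Symbol T g.NT} (hx : ¬IsUseful g x) :
    symbolSeries k g x = 0 :=
  if_neg hx

open scoped Classical in
theorem symbolSeries_terminal (t : T) :
    symbolSeries k g (.terminal t) = Pi.single [t] 1 :=
  (if_pos (isUseful_terminal t)).trans (fiberCount_of_unique k (α := PUnit) fun _ => [t])

theorem symbolSeries_of_hasFiniteFibers {x : Symbol T g.NT}
    (hx : HasFiniteFibers (SymbolTree.yield : SymbolTree g x → List T)) :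
    symbolSeries k g x = fiberCount k (SymbolTree.yield : SymbolTree g x → List T) := by
  by_cases hne : Nonempty (SymbolTree g x)
  · exact if_pos ⟨hne, hx⟩
  · have := not_nonempty_iff.1 hne
    rw [symbolSeries_of_not_isUseful fun h => hne h.1, fiberCount_eq_zero_of_isEmpty]

theorem fiberCount_parseForest_yield {s : List (Symbol T g.NT)}
    (hs : HasFiniteFibers (ParseForest.yield : ParseForest g s → List T)) :
    fiberCount k (ParseForest.yield : ParseForest g s → List T) =
      wordProd (s.map (symbolSeries k g)) := by
  induction s with
  | nil =>
    classical
    exact fiberCount_of_unique k (ParseForest.yield : ParseForest g [] → List T)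
  | cons x s ih =>
    rw [← fiberCount_comp_of_bijective k (ParseForest.cons_bijective x s)]
    rw [show ParseForest.yield ∘ ParseForest.cons = fun f : SymbolTree g x × ParseForest g s =>
      f.1.yield ++ f.2.yield from funext ParseForest.yield_cons]
    have hcons : wordProd ((x :: s).map (symbolSeries k g)) =
      wordConv (symbolSeries k g x) (wordProd (s.map (symbolSeries k g))) := rfl
    rw [hcons]
    rcases isEmpty_or_nonempty (SymbolTree g x) with hx | ⟨⟨t₀⟩⟩
    · rw [fiberCount_eq_zero_of_isEmpty, symbolSeries_of_not_isUseful fun h => hx.false h.1.some,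
        zero_wordConv]
    rcases isEmpty_or_nonempty (ParseForest g s) with hs₀ | ⟨⟨f₀⟩⟩
    · rw [fiberCount_eq_zero_of_isEmpty, ← ih fun _ => Set.toFinite _,
        fiberCount_eq_zero_of_isEmpty, wordConv_zero]
    have hinj := (ParseForest.cons_bijective x s).injective
    have hx : HasFiniteFibers (SymbolTree.yield : SymbolTree g x → List T) :=
      hs.of_injective (c := (· ++ f₀.yield)) (hinj.comp (Prod.mk_left_injective f₀)) fun t =>
        ParseForest.yield_cons (t, f₀)
    have hs' : HasFiniteFibers (ParseForest.yield : ParseForest g s → List T) :=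
      hs.of_injective (c := (t₀.yield ++ ·)) (hinj.comp (Prod.mk_right_injective t₀)) fun f =>
        ParseForest.yield_cons (t₀, f)
    rw [fiberCount_append k hx hs', ih hs', symbolSeries_of_hasFiniteFibers hx]

theorem symbolSeries_nonterminal {A : g.NT} (hA : IsUseful g (.nonterminal A)) :
    symbolSeries k g (.nonterminal A) =
      ∑ r ∈ rulesOf g A, wordProd (r.output.map (symbolSeries k g)) := by
  have hfinite (r : rulesOf g A) :
      HasFiniteFibers (ParseForest.yield : ParseForest g r.1.output → List T) :=
    hA.2.of_injective (e := fun f => ParseTree.ofRule ⟨r, f⟩) (c := id)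
      ((ParseTree.ofRule_bijective A).injective.comp sigma_mk_injective) fun _ => rfl
  calc symbolSeries k g (.nonterminal A)
      = fiberCount k (ParseTree.yield ∘ ParseTree.ofRule (A := A)) :=
        (symbolSeries_of_hasFiniteFibers hA.2).trans
          (fiberCount_comp_of_bijective k (ParseTree.ofRule_bijective A) ParseTree.yield).symm
    _ = ∑ r : rulesOf g A, fiberCount k (ParseForest.yield : ParseForest g r.1.output → List T) :=
        fiberCount_sigma k hfinite
    _ = ∑ r ∈ rulesOf g A, wordProd (r.output.map (symbolSeries k g)) := by
        simp only [fiberCount_parseForest_yield (hfinite _)]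
        exact Finset.sum_coe_sort (rulesOf g A) fun r => wordProd (r.output.map (symbolSeries k g))

end ParseTrees

section Linearization

variable {T : Type u} {g : ContextFreeGrammar.{u} T} {K : Type*} [CommRing K]

/-- The useful nonterminals: the unknowns of the systems of equations of the grammar. -/
abbrev UsefulNT (g : ContextFreeGrammar.{u} T) : Type :=
  {A : g.NT // IsUseful g (.nonterminal A)}

instance : Finite (UsefulNT g) := by
  classical
  refine ((g.rules.image ContextFreeRule.input).finite_toSet.subset ?_).to_subtype
  rintro A ⟨⟨⟨r, hr, rfl, _⟩⟩, _⟩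
  exact Finset.mem_coe.2 (Finset.mem_image_of_mem _ hr)

noncomputable instance : Fintype (UsefulNT g) :=
  Fintype.ofFinite _

noncomputable instance : DecidableEq (UsefulNT g) :=
  Classical.decEq _

open scoped Classical in
/-- The matrix of the linear endomorphism `δ ↦ (∑ r ∈ rulesOf g A, skewDerivation p q r.output δ)_A`
of the functions on the useful nonterminals. -/
noncomputable def linearization (g : ContextFreeGrammar.{u} T) (p q : Symbol T g.NT → K) :
    Matrix (UsefulNT g) (UsefulNT g) K :=
  .of fun A B => ∑ r ∈ rulesOf g A.1, skewDerivation p q r.output (Pi.single (.nonterminal B.1) 1)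

theorem map_linearization {L : Type*} [CommRing L] (φ : K →+* L) (p q : Symbol T g.NT → K) :
    (linearization g p q).map φ = linearization g (φ ∘ p) (φ ∘ q) := by
  classical
  ext A B
  have hsingle : φ ∘ Pi.single (Symbol.nonterminal B.1 : Symbol T g.NT) (1 : K) =
      Pi.single (.nonterminal B.1) 1 := by
    ext x
    simp [Pi.single_apply, apply_ite φ]
  simp [linearization, map_skewDerivation, hsingle]

theorem one_sub_linearization_mem {R : Type*} [CommRing R] [Algebra R K] {S : Subalgebra R K}
    {p q : Symbol T g.NT → K} (hp : ∀ x, p x ∈ S) (hq : ∀ x, q x ∈ S) (A B : UsefulNT g) :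
    (1 - linearization g p q) A B ∈ S := by
  classical
  have hone : (1 : Matrix (UsefulNT g) (UsefulNT g) K) A B ∈ S := by
    rw [Matrix.one_apply]
    split_ifs
    exacts [S.one_mem, S.zero_mem]
  have hsingle (x) : (Pi.single (.nonterminal B.1) 1 : Symbol T g.NT → K) x ∈ S := by
    rw [Pi.single_apply]
    split_ifs
    exacts [S.one_mem, S.zero_mem]
  exact S.sub_mem hone (S.sum_mem fun r _ => skewDerivation_mem hp hq hsingle r.output)

/-- The restriction of a function on symbols to the terminals, extended by `0`. -/
def terminalPart (δ : Symbol T g.NT → K) : Symbol T g.NT → K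
  | .terminal t => δ (.terminal t)
  | .nonterminal _ => 0

open scoped Classical in
theorem terminalPart_add_sum_single {δ : Symbol T g.NT → K} (hδ : ∀ x, ¬IsUseful g x → δ x = 0) :
    terminalPart δ + ∑ B : UsefulNT g, δ (.nonterminal B.1) • Pi.single (.nonterminal B.1) 1 =
      δ := by
  ext x
  cases x with
  | terminal t => simp [terminalPart]
  | nonterminal A =>
    by_cases hA : IsUseful g (.nonterminal A)
    · have hsum := Finset.sum_eq_single_of_mem (f := fun B : UsefulNT g =>
        δ (.nonterminal B.1) * (Pi.single (.nonterminal B.1) 1 : Symbol T g.NT → K)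
          (.nonterminal A)) ⟨A, hA⟩ (Finset.mem_univ _) fun B _ hB => by
            have : A ≠ B.1 := fun h => hB (Subtype.ext h.symm)
            simp [this]
      simpa [terminalPart] using hsum
    · simp only [terminalPart, Pi.add_apply, zero_add, Finset.sum_apply, hδ _ hA]
      refine Finset.sum_eq_zero fun B _ => ?_
      have : A ≠ B.1 := fun h => hA (h ▸ B.2)
      simp [this]

theorem one_sub_linearization_mulVec {p q δ : Symbol T g.NT → K}
    (huseless : ∀ x, ¬IsUseful g x → δ x = 0)
    (hδ : ∀ A : UsefulNT g,
      δ (.nonterminal A.1) = ∑ r ∈ rulesOf g A.1, skewDerivation p q r.output δ) :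
    (1 - linearization g p q).mulVec (fun A => δ (.nonterminal A.1)) =
      fun A => ∑ r ∈ rulesOf g A.1, skewDerivation p q r.output (terminalPart δ) := by
  classical
  ext A
  rw [Matrix.sub_mulVec, Matrix.one_mulVec, Pi.sub_apply, sub_eq_iff_eq_add, hδ]
  conv_lhs => rw [← terminalPart_add_sum_single huseless]
  simp only [map_add, map_sum, map_smul, Finset.sum_add_distrib, Matrix.mulVec, dotProduct,
    linearization, Matrix.of_apply, Finset.sum_mul, smul_eq_mul]
  rw [Finset.sum_comm]
  simp only [mul_comm]

end Linearization

section EmptyWord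

variable {T : Type u} {g : ContextFreeGrammar.{u} T} {k : Type*} [CommRing k]

theorem exists_symbolTree_of_symbolSeries_ne_zero {x : Symbol T g.NT} {w : List T}
    (h : symbolSeries k g x w ≠ 0) : ∃ t : SymbolTree g x, t.yield = w := by
  have hx : IsUseful g x := by
    by_contra hx
    exact h (congrFun (symbolSeries_of_not_isUseful hx) w)
  rw [symbolSeries_of_hasFiniteFibers hx.2] at h
  exact Set.nonempty_of_ncard_ne_zero (s := SymbolTree.yield ⁻¹' {w}) fun h' =>
    h (by rw [fiberCount, h', Nat.cast_zero])

theorem exists_parseForest_yield_eq_nil {s : List (Symbol T g.NT)}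
    (h : (s.map (symbolSeries k g · [])).prod ≠ 0) : ∃ f : ParseForest g s, f.yield = [] := by
  induction s with
  | nil => exact ⟨.nil, rfl⟩
  | cons x s ih =>
    rw [List.map_cons, List.prod_cons] at h
    obtain ⟨f, hf⟩ := ih (right_ne_zero_of_mul h)
    obtain ⟨t, ht⟩ := exists_symbolTree_of_symbolSeries_ne_zero (left_ne_zero_of_mul h)
    exact ⟨.cons (t, f), by rw [ParseForest.yield_cons, ht, hf, List.append_nil]⟩

theorem ParseForest.sizeOf_lt_sizeOf_cons {x : Symbol T g.NT} {s : List (Symbol T g.NT)}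
    (t : SymbolTree g x) (f : ParseForest g s) : sizeOf f < sizeOf (cons (t, f)) := by
  cases x with
  | terminal a =>
    change sizeOf f < sizeOf (ParseForest.terminal a f)
    rw [ParseForest.terminal.sizeOf_spec]
    lia
  | nonterminal A =>
    have hlt (t : ParseTree g A) : sizeOf f < sizeOf (ParseForest.nonterminal t f) := by
      rw [ParseForest.nonterminal.sizeOf_spec]
      lia
    exact hlt t

open scoped Classical in
theorem exists_parseForest_of_skewDerivation_single_ne_zero {B : g.NT} {s : List (Symbol T g.NT)}
    (h : skewDerivation (symbolSeries k g · []) (symbolSeries k g · []) s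
      (Pi.single (.nonterminal B) 1) ≠ 0) (t : ParseTree g B) :
    ∃ f : ParseForest g s, f.yield = t.yield ∧ sizeOf t < sizeOf f := by
  induction s with
  | nil => exact absurd rfl h
  | cons x s ih =>
    rw [skewDerivation_cons] at h
    by_cases hx : (s.map (symbolSeries k g · [])).prod *
        (Pi.single (.nonterminal B) 1 : Symbol T g.NT → k) x = 0
    · rw [hx, zero_add] at h
      obtain ⟨f, hf, hsize⟩ := ih (right_ne_zero_of_mul h)
      obtain ⟨t', ht'⟩ := exists_symbolTree_of_symbolSeries_ne_zero (left_ne_zero_of_mul h)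
      exact ⟨.cons (t', f), by rw [ParseForest.yield_cons, ht', hf, List.nil_append],
        hsize.trans (ParseForest.sizeOf_lt_sizeOf_cons t' f)⟩
    · obtain rfl : x = .nonterminal B := by
        by_contra hne
        exact hx (by rw [Pi.single_eq_of_ne hne, mul_zero])
      obtain ⟨f, hf⟩ := exists_parseForest_yield_eq_nil (left_ne_zero_of_mul hx)
      refine ⟨.nonterminal t f, by rw [ParseForest.yield, hf, List.append_nil], ?_⟩
      simp only [ParseForest.nonterminal.sizeOf_spec]
      lia

theorem exists_parseTree_of_linearization_ne_zero {A B : UsefulNT g}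
    (h : linearization g (symbolSeries k g · []) (symbolSeries k g · []) A B ≠ 0)
    (t : ParseTree g B.1) :
    ∃ t' : ParseTree g A.1, t'.yield = t.yield ∧ sizeOf t < sizeOf t' := by
  obtain ⟨r, hr, h⟩ := Finset.exists_ne_zero_of_sum_ne_zero h
  obtain ⟨f, hf, hsize⟩ := exists_parseForest_of_skewDerivation_single_ne_zero h t
  refine ⟨.ofRule ⟨⟨r, hr⟩, f⟩, hf, hsize.trans ?_⟩
  simp only [ParseTree.ofRule, ParseTree.node.sizeOf_spec]
  lia

/-- A cycle of nonzero entries would produce arbitrarily large parse trees of one string. -/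
theorem wellFounded_linearization_ne_zero : WellFounded fun B A : UsefulNT g =>
    linearization g (symbolSeries k g · []) (symbolSeries k g · []) A B ≠ 0 := by
  set E := fun B A : UsefulNT g =>
    linearization g (symbolSeries k g · []) (symbolSeries k g · []) A B ≠ 0
  have hpath {B A : UsefulNT g} (h : Relation.TransGen E B A) (t : ParseTree g B.1) :
      ∃ t' : ParseTree g A.1, t'.yield = t.yield ∧ sizeOf t < sizeOf t' := by
    induction h with
    | single h => exact exists_parseTree_of_linearization_ne_zero h t
    | tail _ h ih =>
      obtain ⟨t₁, hyield₁, hsize₁⟩ := ih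
      obtain ⟨t₂, hyield₂, hsize₂⟩ := exists_parseTree_of_linearization_ne_zero h t₁
      exact ⟨t₂, hyield₂.trans hyield₁, hsize₁.trans hsize₂⟩
  have hirrefl : Std.Irrefl (Relation.TransGen E) := by
    refine ⟨fun A h => ?_⟩
    obtain ⟨⟨t₀⟩, hfinite⟩ := A.2
    obtain ⟨t, ht, hmax⟩ := Set.exists_max_image _ (sizeOf : ParseTree g A.1 → ℕ)
      (hfinite (ParseTree.yield t₀)) ⟨t₀, rfl⟩
    obtain ⟨t', hyield, hsize⟩ := hpath h t
    exact (hmax t' (hyield.trans ht)).not_gt hsize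
  exact (Finite.wellFounded_of_trans_of_irrefl (Relation.TransGen E)).mono fun _ _ => .single

theorem det_one_sub_linearization_ne_zero [IsDomain k] {K : Type*} [CommRing K] (φ : K →+* k)
    {p q : Symbol T g.NT → K} (hp : ∀ x, φ (p x) = symbolSeries k g x [])
    (hq : ∀ x, φ (q x) = symbolSeries k g x []) : (1 - linearization g p q).det ≠ 0 := by
  intro h
  refine det_one_sub_ne_zero_of_wellFounded (wellFounded_linearization_ne_zero (g := g) (k := k)) ?_
  have hp' : φ ∘ p = (symbolSeries k g · []) := funext hp
  have hq' : φ ∘ q = (symbolSeries k g · []) := funext hq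
  simpa only [RingHom.map_det, map_sub, map_one, RingHom.mapMatrix_apply, map_linearization, hp',
    hq', map_zero] using congrArg φ h

end EmptyWord

section Algebraicity

variable {T : Type u} {g : ContextFreeGrammar.{u} T}

section Polynomials

variable {R K : Type*} [CommRing R] [CommRing K] [Algebra R K]

open MvPolynomial

open scoped Classical in
/-- The polynomial represented by a symbol when the terminals take the values `τ`: the useful
nonterminals are the variables, the other nonterminals are replaced by `0`. -/
noncomputable def symbolPolynomial (g : ContextFreeGrammar.{u} T) (τ : T → R) :
    Symbol T g.NT → MvPolynomial (UsefulNT g) R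
  | .terminal t => C (τ t)
  | .nonterminal A => if h : IsUseful g (.nonterminal A) then X ⟨A, h⟩ else 0

theorem aeval_comp_symbolPolynomial {τ : T → R} {p : Symbol T g.NT → K}
    (hterminal : ∀ t, p (.terminal t) = algebraMap R K (τ t))
    (huseless : ∀ x, ¬IsUseful g x → p x = 0) :
    aeval (fun A : UsefulNT g => p (.nonterminal A.1)) ∘ symbolPolynomial g τ = p := by
  ext x
  cases x with
  | terminal t => simp [symbolPolynomial, hterminal]
  | nonterminal A =>
    by_cases hA : IsUseful g (.nonterminal A)
    · simp [symbolPolynomial, hA]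
    · simp [symbolPolynomial, hA, huseless]

open scoped Classical in
theorem pderiv_symbolPolynomial (τ : T → R) (B : UsefulNT g) (x : Symbol T g.NT) :
    pderiv B (symbolPolynomial g τ x) =
      (Pi.single (.nonterminal B.1) 1 : Symbol T g.NT → MvPolynomial (UsefulNT g) R) x := by
  cases x with
  | terminal t => simp [symbolPolynomial]
  | nonterminal A =>
    by_cases hA : IsUseful g (.nonterminal A)
    · by_cases hAB : A = B.1
      · subst hAB
        simp [symbolPolynomial, hA]
      · have : (⟨A, hA⟩ : UsefulNT g) ≠ B := fun h => hAB (congrArg Subtype.val h)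
        simp [symbolPolynomial, hA, pderiv_X, hAB, this]
    · have hAB : A ≠ B.1 := fun h => hA (h ▸ B.2)
      simp [symbolPolynomial, hA, hAB]

theorem isNondegenerateFixedPoint_symbolPolynomial {τ : T → R} {p : Symbol T g.NT → K}
    (hterminal : ∀ t, p (.terminal t) = algebraMap R K (τ t))
    (huseless : ∀ x, ¬IsUseful g x → p x = 0)
    (hrules : ∀ A : UsefulNT g,
      p (.nonterminal A.1) = ∑ r ∈ rulesOf g A.1, (r.output.map p).prod)
    (hdet : (1 - linearization g p p).det ≠ 0) :
    IsNondegenerateFixedPoint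
      (fun A => ∑ r ∈ rulesOf g A.1, (r.output.map (symbolPolynomial g τ)).prod)
      (fun A : UsefulNT g => p (.nonterminal A.1)) := by
  classical
  set y := fun A : UsefulNT g => p (.nonterminal A.1)
  have hp : aeval y ∘ symbolPolynomial g τ = p := aeval_comp_symbolPolynomial hterminal huseless
  refine ⟨fun A => ?_, ?_⟩
  · simp only [map_sum, map_list_prod, List.map_map, hp]
    exact hrules A
  · convert hdet using 3
    ext A B
    have hsingle : aeval y ∘ pderiv B ∘ symbolPolynomial g τ = Pi.single (.nonterminal B.1) 1 := by
      ext x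
      simp [pderiv_symbolPolynomial, Pi.single_apply, apply_ite (aeval y)]
    simp only [Matrix.of_apply, linearization, map_sum, derivation_list_prod_map]
    refine Finset.sum_congr rfl fun r _ => ?_
    exact (map_skewDerivation (aeval y : _ →ₐ[R] K).toRingHom _ _ _ _).trans
      (congrArg₂ (fun p δ => skewDerivation p p r.output δ) hp hsingle)

end Polynomials

variable {k : Type*} [CommRing k] [IsDomain k]

open PowerSeries

theorem isAlgebraic_letterSeries_symbolSeries (a : T) (x : Symbol T g.NT) :
    IsAlgebraic (Polynomial k) (letterSeries a (symbolSeries k g x)) := by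
  classical
  by_cases hx : IsUseful g x
  swap
  · rw [symbolSeries_of_not_isUseful hx, map_zero]
    exact isAlgebraic_zero
  have hterminal (t : T) : letterSeries a (symbolSeries k g (.terminal t)) =
      algebraMap (Polynomial k) k⟦X⟧ (if a = t then Polynomial.X else 0) := by
    rw [symbolSeries_terminal, letterSeries_single_singleton, apply_ite (algebraMap _ _), map_zero]
    simp [algebraMap_apply']
  cases x with
  | terminal t => exact hterminal t ▸ isAlgebraic_algebraMap _
  | nonterminal A =>
    refine (isNondegenerateFixedPoint_symbolPolynomial
      (p := fun x => letterSeries a (symbolSeries k g x)) hterminal (fun x hx => ?_) (fun A => ?_)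
      ?_).isAlgebraic (⟨A, hx⟩ : UsefulNT g)
    · rw [symbolSeries_of_not_isUseful hx, map_zero]
    · simp only [symbolSeries_nonterminal A.2, map_sum, letterSeries_wordProd, List.map_map]
      rfl
    · exact det_one_sub_linearization_ne_zero constantCoeff
        (fun _ => constantCoeff_letterSeries a _) fun _ => constantCoeff_letterSeries a _

end Algebraicity

section MixedSeries

open PowerSeries

variable {T : Type u} {g : ContextFreeGrammar.{u} T} {k : Type*} [CommRing k]

theorem isAlgebraic_C {f : k⟦X⟧} (hf : IsAlgebraic (Polynomial k) f) :
    IsAlgebraic (Polynomial (Polynomial k)) (C f) := by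
  refine hf.ringHom_of_comp_eq (Polynomial.C : Polynomial k →+* _) (C : k⟦X⟧ →+* _)
    Polynomial.C_injective ?_
  ext <;> simp [algebraMap_apply']

theorem isAlgebraic_map_C {f : k⟦X⟧} (hf : IsAlgebraic (Polynomial k) f) :
    IsAlgebraic (Polynomial (Polynomial k)) (map C f) := by
  refine hf.ringHom_of_comp_eq (Polynomial.mapRingHom Polynomial.C) (map C)
    (Polynomial.map_injective _ Polynomial.C_injective) ?_
  ext <;> simp [algebraMap_apply']

theorem mixedSeries_symbolSeries_nonterminal (a b : T) {A : g.NT}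
    (hA : IsUseful g (.nonterminal A)) :
    mixedSeries a b (symbolSeries k g (.nonterminal A)) =
      ∑ r ∈ rulesOf g A, skewDerivation (fun x => map C (letterSeries a (symbolSeries k g x)))
        (fun x => C (letterSeries b (symbolSeries k g x))) r.output
        fun x => mixedSeries a b (symbolSeries k g x) := by
  simp only [symbolSeries_nonterminal hA, map_sum, mixedSeries_wordProd_map]

variable [IsDomain k]

theorem exists_ne_zero_algebraMap_mul_mixedSeries_mem (a b : T) (A : g.NT) :
    ∃ p : Polynomial (Polynomial k), p ≠ 0 ∧
      algebraMap _ k⟦X⟧⟦X⟧ p * mixedSeries a b (symbolSeries k g (.nonterminal A)) ∈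
        fgCoeffSubalgebra k := by
  classical
  by_cases hA : IsUseful g (.nonterminal A)
  swap
  · exact ⟨1, one_ne_zero, by
      simpa only [symbolSeries_of_not_isUseful hA, map_zero, mul_zero] using zero_mem _⟩
  let S := fgCoeffSubalgebra k ⊓ Subalgebra.algebraicClosure _ k⟦X⟧⟦X⟧
  have ha (x) : map C (letterSeries a (symbolSeries k g x)) ∈ S :=
    ⟨map_C_mem_fgCoeffSubalgebra _, isAlgebraic_map_C (isAlgebraic_letterSeries_symbolSeries a x)⟩
  have hb (x) : C (letterSeries b (symbolSeries k g x)) ∈ S :=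
    ⟨C_mem_fgCoeffSubalgebra _, isAlgebraic_C (isAlgebraic_letterSeries_symbolSeries b x)⟩
  have hterminal : ∀ x, terminalPart (fun x => mixedSeries a b (symbolSeries k g x)) x ∈ S
    | .terminal t => by
      simpa only [terminalPart, symbolSeries_terminal, mixedSeries_single_singleton] using
        hb (.terminal t)
    | .nonterminal _ => S.zero_mem
  have hsystem := one_sub_linearization_mulVec (g := g)
    (δ := fun x => mixedSeries a b (symbolSeries k g x))
    (fun x hx => by rw [symbolSeries_of_not_isUseful hx, map_zero])
    fun B => mixedSeries_symbolSeries_nonterminal a b B.2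
  obtain ⟨p, hp, hmem⟩ := exists_ne_zero_algebraMap_mul_mem_of_mulVec_eq (S := S)
    (fun z hz => hz.2) (one_sub_linearization_mem ha hb)
    (det_one_sub_linearization_ne_zero (constantCoeff.comp constantCoeff)
      (fun _ => by
        rw [RingHom.comp_apply, ← coeff_zero_eq_constantCoeff_apply (map C _), coeff_map,
          constantCoeff_C, coeff_letterSeries, List.replicate_zero])
      fun _ => by simp [constantCoeff_letterSeries])
    (fun _ => S.sum_mem fun r _ => skewDerivation_mem ha hb hterminal r.output)
    hsystem ⟨A, hA⟩
  exact ⟨p, hp, hmem.1⟩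

end MixedSeries

section Main

open PowerSeries

theorem theorem3p2_general (k : Type*) [CommRing k] [IsDomain k] {T : Type u}
    (g : ContextFreeGrammar.{u} T) (A : g.NT) (hg : ∀ w, (parseTrees g A w).Finite) (a b : T) :
    ∃ (d : ℕ) (p : Fin (d + 1) → Polynomial k), p (Fin.last d) ≠ 0 ∧
      ∃ V : Submodule k k⟦X⟧, V.FG ∧ ∀ n, d ≤ n → ∑ i : Fin (d + 1), (p i : k⟦X⟧) * mk (fun m =>
        ((parseTrees g A (List.replicate (n - i) a ++ List.replicate m b)).ncard : k)) ∈ V := by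
  obtain ⟨p, hp, hmixed⟩ := exists_ne_zero_algebraMap_mul_mixedSeries_mem (k := k) (g := g) a b A
  have hmem := (fgCoeffSubalgebra k).add_mem ((fgCoeffSubalgebra k).mul_mem
    ((fgCoeffSubalgebra k).algebraMap_mem p) (map_C_mem_fgCoeffSubalgebra
      (letterSeries a (symbolSeries k g (.nonterminal A))))) hmixed
  rw [← mul_add] at hmem
  obtain ⟨V, hV, hmem⟩ := hmem
  refine ⟨p.natDegree, fun i => p.coeff i, Polynomial.leadingCoeff_ne_zero.2 hp, V, hV,
    fun n hn => ?_⟩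
  have hcoeff := hmem n
  simp only [coeff_algebraMap_polynomial_mul p _ hn, coeff_map_letterSeries_add_mixedSeries,
    symbolSeries_of_hasFiniteFibers (x := .nonterminal A) hg] at hcoeff
  exact hcoeff

theorem coeffA_dual_language {T : Type u} (a b : T) (G : GF2Grammar T) (n : ℕ) :
    coeffA (dual a b G.language) n = mk fun m => ((parseTrees G.toContextFreeGrammar G.initial
      (List.replicate n a ++ List.replicate m b)).ncard : ZMod 2) := by
  classical
  ext m
  set e : Fin 2 →₀ ℕ := Finsupp.single 0 n + Finsupp.single 1 m with he
  have h₀ : e 0 = n := by simp [he]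
  have h₁ : e 1 = m := by simp [he]
  rw [coeffA, coeff_mk, coeff_mk, MvPowerSeries.coeff_apply, dual, h₀, h₁]
  split_ifs with h
  · exact (ZMod.natCast_eq_one_iff_odd.2 h).symm
  · exact (ZMod.natCast_eq_zero_iff_even.2 (Nat.not_odd_iff_even.1 h)).symm

theorem finite_of_submodule_fg {k M : Type*} [Ring k] [Finite k] [AddCommGroup M] [Module k M]
    {V : Submodule k M} (hV : V.FG) : (V : Set M).Finite :=
  have : Module.Finite k V := Module.Finite.iff_fg.2 hV
  Module.finite_of_finite k

end Main

theorem theorem3p2 {T : Type*} (a b : T) (hab : a ≠ b) (L : Language T)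
    (hL : L ≤ starStar a b) (hG : IsGF2Grammatical L) :
    ∃ (d : ℕ) (p : Fin (d + 1) → Polynomial (ZMod 2)),
      p (Fin.last d) ≠ 0 ∧
      {s : PowerSeries (ZMod 2) | ∃ n : ℕ, d < n ∧
        s = ∑ i : Fin (d + 1),
          (p i : PowerSeries (ZMod 2)) * coeffA (dual a b L) (n - (i : ℕ))}.Finite := by
  obtain ⟨G, rfl⟩ := hG
  obtain ⟨d, p, hp, V, hV, hmem⟩ :=
    theorem3p2_general (ZMod 2) G.toContextFreeGrammar G.initial G.finite_parseTrees a b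
  refine ⟨d, p, hp, (finite_of_submodule_fg hV).subset ?_⟩
  rintro _ ⟨n, hn, rfl⟩
  simpa only [coeffA_dual_language, SetLike.mem_coe] using hmem n hn.le
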